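/- For $k\in\mathbb N$ let $\mathrm{FIN}_k$ be the set of finitely supported functions $p:\mathbb N\to\{0,\dots,k\}$ that attain the value $k$. Write $\operatorname{supp}(p)=\{n: p(n)\neq 0\}$, let $p<q$ mean $\max\operatorname{supp}(p)<\min\operatorname{supp}(q)$, and let $T(p)(n)=\max(p(n)-1,0)$. A block sequence in $\mathrm{FIN}_k$ is an infinite sequence $B=(b_n)_{n\in\mathbb N}$ in $\mathrm{FIN}_k$ with $b_0<b_1<b_2<\cdots$, and the combinatorial subspace generated by $B$ is $$\langle B\rangle=\Big\{\sum_{n\in\mathbb N}T^{\,k-f(n)}(b_n)\ \Big|\ f\in\mathrm{FIN}_k\Big\}\subseteq\mathrm{FIN}_k$$ (the sums are finite, since $T^k(b_n)=0$). Elements of $\mathrm{FIN}_k$ are identified with natural numbers through a standard coding of finite sequences, so that one can speak of recursive functions on $\mathrm{FIN}_k$ and of the Turing degree of a subset of $\mathrm{FIN}_k$. Let $\emptyset^{(k)}$ denote the $k$-th iterate of the Turing jump applied to $\emptyset$, with $\emptyset^{(0)}=\emptyset$. **Theorem.** For every $k\in\mathbb N$ there exists a recursive coloring $c:\mathrm{FIN}_{k+1}\to\{0,\dots,2^k-1\}$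 such that every combinatorial subspace $S\subseteq\mathrm{FIN}_{k+1}$ on which $c$ is constant computes $\emptyset^{(k)}$, i.e. $\emptyset^{(k)}\le_T S$. -/

import Mathlib

open scoped Computability

/-! ### The spaces `FIN_k` -/

/-- `FIN_k`: the finitely supported functions `p : ℕ → [0, k]` that attain the value `k`. -/
abbrev FIN (k : ℕ) : Type :=
  {p : ℕ →₀ ℕ // (∀ n, p n ≤ k) ∧ ∃ n, p n = k}

/-- The tetris operation `T(p)(n) = p(n) ∸ 1` (truncated subtraction). -/
noncomputable def tetris (p : ℕ →₀ ℕ) : ℕ →₀ ℕ :=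
  p.mapRange (fun a => a - 1) rfl

/-- The order `p < q` iff `max supp p < min supp q`. -/
def Precedes (p q : ℕ →₀ ℕ) : Prop :=
  ∀ m ∈ p.support, ∀ n ∈ q.support, m < n

/-- A block sequence in `FIN_k`: an infinite sequence that is increasing for `Precedes`. -/
def IsBlockSequence {k : ℕ} (B : ℕ → FIN k) : Prop :=
  ∀ m n, m < n → Precedes (B m).1 (B n).1

/-- The sum `∑ n, T^{k - f(n)} (b_n)`. Only `n` in the support of `f` contribute, because
`T^k (b_n) = 0` for `b_n` in `FIN_k`. -/
noncomputable def blockSum {k : ℕ} (B : ℕ → FIN k) (f : FIN k) : ℕ →₀ ℕ :=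
  ∑ n ∈ f.1.support, tetris^[k - f.1 n] (B n).1

/-- The combinatorial subspace `⟨B⟩` generated by `B`. -/
def combinatorialSpan {k : ℕ} (B : ℕ → FIN k) : Set (FIN k) :=
  {p | ∃ f : FIN k, p.1 = blockSum B f}

/-- `S` is a combinatorial subspace of `FIN_k`. -/
def IsCombinatorialSubspace {k : ℕ} (S : Set (FIN k)) : Prop :=
  ∃ B : ℕ → FIN k, IsBlockSequence B ∧ S = combinatorialSpan B

/-- `S` is monochromatic for the coloring `c`. -/
def IsMonochromatic {k r : ℕ} (c : FIN k → Fin r) (S : Set (FIN k)) : Prop :=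
  ∃ a : Fin r, ∀ p ∈ S, c p = a

/-! ### Coding by natural numbers -/

/-- The code of `p`: the number of the finite sequence `(p(0), …, p(max supp p))`. -/
def FIN.code {k : ℕ} (p : FIN k) : ℕ :=
  Encodable.encode ((List.range (p.1.support.sup id + 1)).map p.1)

/-- The coloring `c` is recursive: its value is computed by a recursive function from the code. -/
def IsRecursiveColoring {k r : ℕ} (c : FIN k → Fin r) : Prop :=
  ∃ F : ℕ → ℕ, Computable F ∧ ∀ p : FIN k, F p.code = (c p : ℕ)

/-- A subset of `FIN_k` regarded as a set of natural numbers. -/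
def codeSet {k : ℕ} (S : Set (FIN k)) : Set ℕ :=
  FIN.code '' S

/-! ### Relative computability and the Turing jump -/

open Classical in
/-- The characteristic function of a set of natural numbers. -/
noncomputable def charFn (A : Set ℕ) (n : ℕ) : ℕ :=
  if n ∈ A then 1 else 0

/-- `A` computes `X`, that is, `X` is Turing reducible to `A`. -/
def Computes (A X : Set ℕ) : Prop :=
  (charFn X : ℕ →. ℕ) ≤ᵀ (charFn A : ℕ →. ℕ)

/-- The initial segment of length `n` of the characteristic function of `A`. -/
noncomputable def initSeg (A : Set ℕ) (n : ℕ) : List ℕ :=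
  (List.range n).map (charFn A)

/-- The set `W_e^A`, the `e`-th set recursively enumerable in `A`: a number `x` belongs to it iff
the `e`-th program halts on `x` together with some finite initial segment of the oracle. -/
def relRE (e : ℕ) (A : Set ℕ) : Set ℕ :=
  {x | ∃ n, ((Denumerable.ofNat Nat.Partrec.Code e).eval
    (Nat.pair x (Encodable.encode (initSeg A n)))).Dom}

/-- The Turing jump `A' = {e | e ∈ W_e^A}`. -/
def turingJump (A : Set ℕ) : Set ℕ :=
  {e | e ∈ relRE e A}

/-- The iterated jump `∅^{(k)}`. -/
def iterJump (k : ℕ) : Set ℕ :=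
  turingJump^[k] ∅

/-! ### Sanity facts: the sums defining `⟨B⟩` lie in `FIN_k`, and `A'` is a complete set among
those recursively enumerable in `A` -/

theorem tetris_iterate_apply (p : ℕ →₀ ℕ) (j m : ℕ) : tetris^[j] p m = p m - j := by
  induction j generalizing p with
  | zero => rfl
  | succ j ih => rw [Function.iterate_succ_apply, ih]; simp [tetris]; omega

/-- For a block sequence `B` and `f` in `FIN_k`, the sum is again in `FIN_k`. -/
theorem exists_eq_blockSum {k : ℕ} {B : ℕ → FIN k} (hB : IsBlockSequence B) (f : FIN k) :
    ∃ p : FIN k, p.1 = blockSum B f := by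
  have val : ∀ m, blockSum B f m = ∑ n ∈ f.1.support, ((B n).1 m - (k - f.1 n)) := by
    intro m; simp [blockSum, Finsupp.finsetSum_apply, tetris_iterate_apply]
  have disj : ∀ m n n', (B n).1 m ≠ 0 → n' ≠ n → (B n').1 m = 0 := by
    intro m n n' h hn
    by_contra h'
    rcases lt_or_gt_of_ne hn with h1 | h1
    · exact absurd (hB _ _ h1 m (by simpa using h') m (by simpa using h)) (lt_irrefl _)
    · exact absurd (hB _ _ h1 m (by simpa using h) m (by simpa using h')) (lt_irrefl _)
  have single : ∀ m n, (B n).1 m ≠ 0 → blockSum B f m = (B n).1 m - (k - f.1 n) := by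
    intro m n h
    rw [val, Finset.sum_eq_single n]
    · intro n' _ hn; simp [disj m n n' h hn]
    · intro hn
      have := (B n).2.1 m
      have h0 : f.1 n = 0 := by simpa using hn
      omega
  refine ⟨⟨blockSum B f, fun m => ?_, ?_⟩, rfl⟩
  · by_cases h : ∃ n, (B n).1 m ≠ 0
    · obtain ⟨n, h⟩ := h
      rw [single m n h]
      have := (B n).2.1 m
      omega
    · push Not at h
      rw [val]; simp [h]
  · obtain ⟨n, hn⟩ := f.2.2
    obtain ⟨m, hm⟩ := (B n).2.2
    refine ⟨m, ?_⟩
    by_cases h : (B n).1 m = 0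
    · have hk : k = 0 := by omega
      rw [val]
      refine (Finset.sum_eq_zero fun i _ => ?_).trans hk.symm
      have := (B i).2.1 m
      omega
    · rw [single m n h, hn, hm]; simp

/-- `f` is the limit of a partial recursive function applied to the initial segments of `A`. -/
def HasApprox (A : Set ℕ) (f : ℕ →. ℕ) : Prop :=
  ∃ ψ : List ℕ → ℕ → Part ℕ, Partrec₂ ψ ∧
    (∀ m n x y, m ≤ n → y ∈ ψ (initSeg A m) x → y ∈ ψ (initSeg A n) x) ∧
    ∀ x y, y ∈ f x ↔ ∃ n, y ∈ ψ (initSeg A n) x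

theorem HasApprox.of_partrec {A : Set ℕ} {f : ℕ →. ℕ} (hf : Nat.Partrec f) : HasApprox A f :=
  ⟨fun _ x => f x, (Partrec.nat_iff.2 hf).comp Computable.snd, fun _ _ _ _ _ h => h,
    fun _ _ => ⟨fun h => ⟨0, h⟩, fun ⟨_, h⟩ => h⟩⟩

theorem HasApprox.of_recursiveIn {A : Set ℕ} {f : ℕ →. ℕ}
    (hf : Nat.RecursiveIn {(charFn A : ℕ →. ℕ)} f) : HasApprox A f := by
  induction hf with
  | zero => exact .of_partrec .zero
  | succ => exact .of_partrec .succ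
  | left => exact .of_partrec .left
  | right => exact .of_partrec .right
  | oracle g hg =>
    obtain rfl : g = (charFn A : ℕ →. ℕ) := hg
    have hget : ∀ n x y, y ∈ (initSeg A n)[x]? ↔ x < n ∧ y = charFn A x := by
      intro n x y
      by_cases h : x < n
      · simp [initSeg, h, eq_comm]
      · simp [initSeg, h]
    refine ⟨fun σ x => (σ[x]? : Option ℕ), ?_, ?_, ?_⟩
    · exact Computable.ofOption Primrec.list_getElem?.to_comp
    · intro m n x y hmn h
      rw [Part.mem_coe, hget] at h ⊢
      exact ⟨h.1.trans_le hmn, h.2⟩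
    · intro x y
      simp only [Part.mem_coe, hget]
      have e : y ∈ (charFn A : ℕ →. ℕ) x ↔ y = charFn A x := Part.mem_some_iff
      refine e.trans (Iff.intro (fun h => ?_) fun h => ?_)
      · exact ⟨x + 1, by omega, h⟩
      · exact h.elim fun _ h => h.2
  | @pair f h _ _ ihf ihh =>
    obtain ⟨φ, pφ, mφ, lφ⟩ := ihf
    obtain ⟨ψ, pψ, mψ, lψ⟩ := ihh
    refine ⟨fun σ x => (φ σ x).bind fun a => (ψ σ x).map fun b => Nat.pair a b, ?_, ?_, ?_⟩
    · refine Partrec.bind pφ ?_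
      refine Partrec.map (pψ.comp (Computable.fst.comp Computable.fst)
        (Computable.snd.comp Computable.fst)) ?_
      exact (Primrec₂.natPair.comp (Primrec.snd.comp Primrec.fst) Primrec.snd).to_comp
    · intro m n x y hmn hy
      simp only [Part.mem_bind_iff, Part.mem_map_iff] at hy ⊢
      obtain ⟨a, ha, b, hb, e⟩ := hy
      exact ⟨a, mφ _ _ _ _ hmn ha, b, mψ _ _ _ _ hmn hb, e⟩
    · intro x y
      simp only [Seq.seq, Part.map_eq_map, Part.mem_bind_iff, Part.mem_map_iff]
      constructor
      · rintro ⟨_, ⟨a, ha, rfl⟩, b, hb, e⟩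
        obtain ⟨m, ha⟩ := (lφ _ _).1 ha
        obtain ⟨n, hb⟩ := (lψ _ _).1 hb
        exact ⟨max m n, a, mφ _ _ _ _ (le_max_left _ _) ha, b,
          mψ _ _ _ _ (le_max_right _ _) hb, e⟩
      · rintro ⟨n, a, ha, b, hb, e⟩
        exact ⟨_, ⟨a, (lφ _ _).2 ⟨n, ha⟩, rfl⟩, b, (lψ _ _).2 ⟨n, hb⟩, e⟩
  | @comp f h _ _ ihf ihh =>
    obtain ⟨φ, pφ, mφ, lφ⟩ := ihf
    obtain ⟨ψ, pψ, mψ, lψ⟩ := ihh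
    refine ⟨fun σ x => (ψ σ x).bind fun a => φ σ a, ?_, ?_, ?_⟩
    · exact Partrec.bind pψ (pφ.comp (Computable.fst.comp Computable.fst) Computable.snd)
    · intro m n x y hmn hy
      simp only [Part.mem_bind_iff] at hy ⊢
      obtain ⟨a, ha, hb⟩ := hy
      exact ⟨a, mψ _ _ _ _ hmn ha, mφ _ _ _ _ hmn hb⟩
    · intro x y
      refine (Part.mem_bind_iff (f := h x) (g := f)).trans ?_
      simp only [Part.mem_bind_iff]
      constructor
      · rintro ⟨a, ha, hb⟩
        obtain ⟨m, ha⟩ := (lψ _ _).1 ha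
        obtain ⟨n, hb⟩ := (lφ _ _).1 hb
        exact ⟨max m n, a, mψ _ _ _ _ (le_max_left _ _) ha, mφ _ _ _ _ (le_max_right _ _) hb⟩
      · rintro ⟨n, a, ha, hb⟩
        exact ⟨a, (lψ _ _).2 ⟨n, ha⟩, (lφ _ _).2 ⟨n, hb⟩⟩
  | @prec f h _ _ ihf ihh =>
    obtain ⟨φ, pφ, mφ, lφ⟩ := ihf
    obtain ⟨ψ, pψ, mψ, lψ⟩ := ihh
    let R : List ℕ → ℕ → ℕ → Part ℕ := fun σ a n =>
      n.rec (φ σ a) fun y IH => IH.bind fun i => ψ σ (Nat.pair a (Nat.pair y i))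
    have mR : ∀ m n a b y, m ≤ n → y ∈ R (initSeg A m) a b → y ∈ R (initSeg A n) a b := by
      intro m n a b
      induction b with
      | zero => intro y hmn hy; exact mφ _ _ _ _ hmn hy
      | succ b ih =>
        intro y hmn hy
        obtain ⟨i, hi, hy⟩ := Part.mem_bind_iff.1 hy
        exact Part.mem_bind_iff.2 ⟨i, ih i hmn hi, mψ _ _ _ _ hmn hy⟩
    refine ⟨fun σ p => R σ p.unpair.1 p.unpair.2, ?_, fun m n x y => mR m n _ _ y, ?_⟩
    · refine Partrec.nat_rec (f := fun p : List ℕ × ℕ => p.2.unpair.2)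
        (g := fun p : List ℕ × ℕ => φ p.1 p.2.unpair.1)
        (h := fun p q => ψ p.1 (Nat.pair p.2.unpair.1 (Nat.pair q.1 q.2))) ?_ ?_ ?_
      · exact (Primrec.snd.comp (Primrec.unpair.comp Primrec.snd)).to_comp
      · exact pφ.comp Computable.fst
          (Primrec.fst.comp (Primrec.unpair.comp Primrec.snd)).to_comp
      · refine pψ.comp (Computable.fst.comp Computable.fst) ?_
        exact (Primrec₂.natPair.comp
          (Primrec.fst.comp (Primrec.unpair.comp (Primrec.snd.comp Primrec.fst)))
          (Primrec₂.natPair.comp (Primrec.fst.comp Primrec.snd)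
            (Primrec.snd.comp Primrec.snd))).to_comp
    · intro x y
      rcases hx : x.unpair with ⟨a, b⟩
      simp only [hx]
      clear hx
      induction b generalizing y with
      | zero => exact lφ a y
      | succ b ih =>
        simp only [Part.bind_eq_bind, Part.mem_bind_iff]
        constructor
        · rintro ⟨i, hi, hy⟩
          obtain ⟨m, hi⟩ := (ih i).1 (by simpa using hi)
          obtain ⟨n, hy⟩ := (lψ _ _).1 hy
          exact ⟨max m n, Part.mem_bind_iff.2 ⟨i, mR _ _ _ _ _ (le_max_left _ _) hi,
            mψ _ _ _ _ (le_max_right _ _) hy⟩⟩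
        · rintro ⟨n, hn⟩
          obtain ⟨i, hi, hy⟩ := Part.mem_bind_iff.1 hn
          exact ⟨i, by simpa using (ih i).2 ⟨n, hi⟩, (lψ _ _).2 ⟨n, hy⟩⟩
  | @rfind f _ ihf =>
    obtain ⟨φ, pφ, mφ, lφ⟩ := ihf
    refine ⟨fun σ a => Nat.rfind fun n => (φ σ (Nat.pair a n)).map fun m => decide (m = 0),
      ?_, ?_, ?_⟩
    · refine Partrec.rfind (p := fun (q : List ℕ × ℕ) n =>
        (φ q.1 (Nat.pair q.2 n)).map fun m => decide (m = 0)) ?_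
      refine Partrec.map (pφ.comp (Computable.fst.comp Computable.fst)
        (Primrec₂.natPair.comp (Primrec.snd.comp Primrec.fst) Primrec.snd).to_comp) ?_
      exact (Primrec.eq.comp Primrec.snd (Primrec.const 0)).decide.to_comp
    · intro m n x y hmn hy
      refine Nat.mem_rfind.2 ?_
      replace hy := Nat.mem_rfind.1 hy
      refine ⟨?_, fun {j} hj => ?_⟩
      · obtain ⟨a, ha, e⟩ := (Part.mem_map_iff _).1 hy.1
        exact (Part.mem_map_iff _).2 ⟨a, mφ _ _ _ _ hmn ha, e⟩
      · obtain ⟨a, ha, e⟩ := (Part.mem_map_iff _).1 (hy.2 hj)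
        exact (Part.mem_map_iff _).2 ⟨a, mφ _ _ _ _ hmn ha, e⟩
    · intro x y
      have e1 := Nat.mem_rfind (n := y)
        (p := fun n => (f (Nat.pair x n)).map fun m => decide (m = 0))
      refine e1.trans (Iff.trans ?_ (exists_congr fun n => (Nat.mem_rfind
        (p := fun j => (φ (initSeg A n) (Nat.pair x j)).map fun m => decide (m = 0))).symm))
      simp only [Part.mem_map_iff]
      constructor
      · rintro ⟨⟨a, ha, e⟩, h⟩
        obtain ⟨n₀, ha⟩ := (lφ _ _).1 ha
        have : ∀ j, ∃ n, j < y →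
            ∃ a, a ∈ φ (initSeg A n) (Nat.pair x j) ∧ decide (a = 0) = false := by
          intro j
          by_cases hj : j < y
          · obtain ⟨a, ha, e⟩ := h hj
            obtain ⟨n, ha⟩ := (lφ _ _).1 ha
            exact ⟨n, fun _ => ⟨a, ha, e⟩⟩
          · exact ⟨0, fun h => absurd h hj⟩
        choose N hN using this
        refine ⟨max n₀ ((Finset.range y).sup N),
          ⟨a, mφ _ _ _ _ (le_max_left _ _) ha, e⟩, fun {j} hj => ?_⟩
        obtain ⟨a, ha, e⟩ := hN j hj
        exact ⟨a, mφ _ _ _ _ ((Finset.le_sup (Finset.mem_range.2 hj)).trans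
          (le_max_right _ _)) ha, e⟩
      · rintro ⟨n, ⟨a, ha, e⟩, h⟩
        refine ⟨⟨a, (lφ _ _).2 ⟨n, ha⟩, e⟩, fun {j} hj => ?_⟩
        obtain ⟨a, ha, e⟩ := h hj
        exact ⟨a, (lφ _ _).2 ⟨n, ha⟩, e⟩

/-- Every set recursively enumerable in `A` is some `W_e^A`. -/
theorem exists_eq_relRE {A : Set ℕ} {f : ℕ →. ℕ}
    (hf : Nat.RecursiveIn {(charFn A : ℕ →. ℕ)} f) : ∃ e, {x | (f x).Dom} = relRE e A := by
  obtain ⟨ψ, pψ, -, lψ⟩ := HasApprox.of_recursiveIn hf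
  have : Partrec fun p : ℕ => ψ ((Encodable.decode (α := List ℕ) p.unpair.2).getD []) p.unpair.1 :=
    pψ.comp (Computable.option_getD (Computable.decode.comp
        (Primrec.snd.comp Primrec.unpair).to_comp) (Computable.const []))
      (Primrec.fst.comp Primrec.unpair).to_comp
  obtain ⟨c, hc⟩ := Nat.Partrec.Code.exists_code.1 (Partrec.nat_iff.1 this)
  refine ⟨Encodable.encode c, ?_⟩
  ext x
  simp only [relRE, Set.mem_ofPred_eq, Denumerable.ofNat_encode, hc, Nat.unpair_pair,
    Encodable.encodek, Option.getD_some, Part.dom_iff_mem, lψ]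
  exact exists_comm

/-- A set recursively enumerable in `A` is many-one reducible to the jump of `A`. -/
theorem manyOneReducible_turingJump {A : Set ℕ} {f : ℕ →. ℕ}
    (hf : Nat.RecursiveIn {(charFn A : ℕ →. ℕ)} f) :
    (fun x => (f x).Dom) ≤₀ (fun x => x ∈ turingJump A) := by
  obtain ⟨e, he⟩ := exists_eq_relRE hf
  have : Partrec fun p : ℕ => (Denumerable.ofNat Nat.Partrec.Code e).eval
      (Nat.pair p.unpair.1 p.unpair.2.unpair.2) :=
    Nat.Partrec.Code.eval_part.comp (Computable.const _)
      (Primrec₂.natPair.comp (Primrec.fst.comp Primrec.unpair)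
        (Primrec.snd.comp (Primrec.unpair.comp (Primrec.snd.comp Primrec.unpair)))).to_comp
  obtain ⟨c, hc⟩ := Nat.Partrec.Code.exists_code.1 (Partrec.nat_iff.1 this)
  refine ⟨fun x => Encodable.encode (c.curry x), ?_, fun x => ?_⟩
  · exact (Primrec.encode.comp
      (Nat.Partrec.Code.primrec₂_curry.comp (Primrec.const c) Primrec.id)).to_comp
  · have h1 : (f x).Dom ↔ x ∈ relRE e A := by rw [← he]; rfl
    refine h1.trans ?_
    simp [turingJump, relRE, hc]

/-- The jump of `A` is recursively enumerable in `A`. -/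
theorem turingJump_re (A : Set ℕ) : ∃ f : ℕ →. ℕ,
    Nat.RecursiveIn {(charFn A : ℕ →. ℕ)} f ∧ {x | (f x).Dom} = turingJump A := by
  let R (g : ℕ → ℕ) : Prop := Nat.RecursiveIn {(charFn A : ℕ →. ℕ)} (g : ℕ →. ℕ)
  have rprim : ∀ {g : ℕ → ℕ}, Primrec g → R g := fun h =>
    Nat.Primrec.recursiveIn (Primrec.nat_iff.1 h)
  have rcomp : ∀ {g h : ℕ → ℕ}, R g → R h → R (fun n => g (h n)) := fun hg hh =>
    (Nat.RecursiveIn.comp hg hh).of_eq fun n => Part.bind_some _ _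
  have rpair : ∀ {g h : ℕ → ℕ}, R g → R h → R (fun n => Nat.pair (g n) (h n)) := fun hg hh =>
    (Nat.RecursiveIn.pair hg hh).of_eq fun n => by simp [Seq.seq, PFun.coe_val]
  have rorac : R (charFn A) := Nat.RecursiveIn.oracle _ (Set.mem_singleton _)
  have pu2 : Primrec fun p : ℕ => p.unpair.2 := Primrec.snd.comp Primrec.unpair
  have pu1 : Primrec fun p : ℕ => p.unpair.1 := Primrec.fst.comp Primrec.unpair
  have happ : Primrec fun p : ℕ => Encodable.encode
      (((Encodable.decode (α := List ℕ) p.unpair.1).getD []) ++ [p.unpair.2]) :=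
    Primrec.encode.comp (Primrec.list_append.comp
      (Primrec.option_getD.comp (Primrec.decode.comp pu1) (Primrec.const []))
      (Primrec.list_cons.comp pu2 (Primrec.const [])))
  have hseg' : R fun p => Encodable.encode (initSeg A p.unpair.2) := by
    refine (Nat.RecursiveIn.prec (rprim (Primrec.const (Encodable.encode ([] : List ℕ))))
      (rcomp (rprim happ) (rpair (rprim (pu2.comp pu2))
        (rcomp rorac (rprim (pu1.comp pu2)))))).of_eq fun p => ?_
    obtain ⟨a, n, rfl⟩ : ∃ a n, p = Nat.pair a n := ⟨_, _, (Nat.pair_unpair p).symm⟩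
    simp only [Nat.unpair_pair]
    induction n with
    | zero => simp [initSeg, PFun.coe_val]
    | succ n ih =>
      refine (congrArg (fun o : Part ℕ => o.bind _) ih).trans ?_
      refine (Part.bind_some _ _).trans ?_
      simp [initSeg, PFun.coe_val, List.range_succ]
  have hseg : R fun n => Encodable.encode (initSeg A n) := by
    have := rcomp hseg' (rprim (Primrec₂.natPair.comp (Primrec.const 0) Primrec.id))
    simpa using this
  have hev : Primrec fun p : ℕ => cond ((Nat.Partrec.Code.evaln p.unpair.2.unpair.1
      (Denumerable.ofNat Nat.Partrec.Code p.unpair.1)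
      (Nat.pair p.unpair.1 p.unpair.2.unpair.2)).isSome) 0 1 := by
    refine Primrec.cond (Primrec.option_isSome.comp
      (Nat.Partrec.Code.primrec_evaln.comp (Primrec.pair (Primrec.pair (pu1.comp pu2)
        ((Primrec.ofNat _).comp pu1)) (Primrec₂.natPair.comp pu1 (pu2.comp pu2)))))
      (Primrec.const 0) (Primrec.const 1)
  have hall := Nat.RecursiveIn.rfind (rcomp (rprim hev) (rpair (rprim pu1)
    (rpair (rprim (pu1.comp pu2)) (rcomp hseg (rprim (pu2.comp pu2))))))
  refine ⟨_, hall, ?_⟩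
  ext e
  refine Nat.rfind_dom.trans ?_
  simp only [turingJump, relRE]
  constructor
  · rintro ⟨m, hm, -⟩
    refine ⟨m.unpair.2, ?_⟩
    by_cases h : (Nat.Partrec.Code.evaln m.unpair.1
      (Denumerable.ofNat Nat.Partrec.Code e)
      (Nat.pair e (Encodable.encode (initSeg A m.unpair.2)))).isSome
    · obtain ⟨v, hv⟩ := Option.isSome_iff_exists.1 h
      exact Part.dom_iff_mem.2 ⟨v, Nat.Partrec.Code.evaln_sound hv⟩
    · simp [PFun.coe_val, h] at hm
  · rintro ⟨n, hn⟩
    obtain ⟨v, hv⟩ := Part.dom_iff_mem.1 hn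
    obtain ⟨t, ht⟩ := Nat.Partrec.Code.evaln_complete.1 hv
    refine ⟨Nat.pair t n, ?_, fun _ => trivial⟩
    have ht' := Option.mem_def.1 ht
    simp [PFun.coe_val, ht']

/-!
The coloring is an iterated form of the Blass–Hirst–Simpson coloring for Hindman's theorem. Let
`K = k + 1`. For `p` in `FIN_K`, consider the list of positions where `p` takes the value `K`, and
call a gap `(a, b)` between consecutive entries short for `∅^{(j + 1)}` if some number below `a`
lies in `∅^{(j + 1)}` but is not enumerated into it, with oracle `∅^{(j)}`, by stage `b`. For each
`j < k` the color of `p` contains one bit: the parity of the number of gaps that look short. To make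
this recursive, `∅^{(j + 1)}` is replaced by its enumeration up to the last entry, and the oracle
`∅^{(j)}` by an approximation (`approxJump`), for which `p` itself supplies the stages: the last
positions of a value at least `K - 1, …, K - j`.

Let `S` be a homogeneous subspace. By induction on `j < k`, whenever `p < q` in `S`, the last top
position of `q` is a correct stage for `∅^{(j + 1)}` below the last top position of `p`
(`StageCorrect`, proved in `IsCombinatorialSubspace.stageCorrect_of_isMonochromatic`). For the
induction step, take a chain `p < r₁ < ⋯ < r_j` in `S`. The element `p + T(r₁) + ⋯ + T^j(r_j)` of `S`
has the same top positions as `p`, and by induction its lower levels provide correct stages for the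
oracle (`IsCombinatorialSubspace.exists_sum_tetris`). Hence its bit is computed from the true oracle,
and the parity argument `mem_stage_of_parity_gapCount` applies: adding to `p` an element `q` very far
to the right shows that each `p` in `S` has an even number of short gaps, and then comparing `p`, `q`
and `p + q` shows that the gap between `p` and `q` is never short.

Finally, `S` can search itself for chains `r₀ < ⋯ < r_k` starting arbitrarily far to the right, and
the approximation of `∅^{(k)}` along such a chain is correct
(`IsCombinatorialSubspace.computes_iterJump`).
-/

open Nat.Partrec (Code)

/-! ### Stagewise enumeration of the jump -/

/-- `Enters σ e`: reading only the finite oracle segment `σ`, and running for `σ.length` steps,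
the `e`-th program is seen to halt on `e`. Since the length of `σ` also bounds the running time,
`{e | Enters (initSeg A t) e}` is a decidable-in-`A` enumeration of the jump of `A` by stages `t`. -/
def Enters (σ : List ℕ) (e : ℕ) : Prop :=
  ∃ n ∈ List.range (σ.length + 1), (Code.evaln σ.length (Denumerable.ofNat Code e)
    (Nat.pair e (Encodable.encode (σ.take n)))).isSome = true

theorem length_initSeg (A : Set ℕ) (n : ℕ) : (initSeg A n).length = n := by simp [initSeg]

theorem take_initSeg (A : Set ℕ) {m n : ℕ} (h : m ≤ n) :
    (initSeg A n).take m = initSeg A m := by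
  simp [initSeg, ← List.map_take, List.take_range, h]

theorem enters_initSeg_mono (A : Set ℕ) : Monotone fun t => {e | Enters (initSeg A t) e} := by
  rintro s t hst e ⟨n, hn, h⟩
  simp only [List.mem_range, length_initSeg] at hn h
  refine ⟨n, by simp only [List.mem_range, length_initSeg]; omega, ?_⟩
  rw [take_initSeg _ (by omega)] at h ⊢
  rw [length_initSeg]
  obtain ⟨v, hv⟩ := Option.isSome_iff_exists.1 h
  exact Option.isSome_iff_exists.2 ⟨v, Code.evaln_mono hst hv⟩

theorem mem_turingJump_iff (A : Set ℕ) (e : ℕ) :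
    e ∈ turingJump A ↔ ∃ t, Enters (initSeg A t) e := by
  constructor
  · rintro ⟨n, hn⟩
    obtain ⟨v, hv⟩ := Part.dom_iff_mem.1 hn
    obtain ⟨s, hs⟩ := Code.evaln_complete.1 hv
    refine ⟨max s n, n, by simp only [List.mem_range, length_initSeg]; omega, ?_⟩
    rw [take_initSeg _ (le_max_right _ _), length_initSeg]
    exact Option.isSome_iff_exists.2 ⟨v, Code.evaln_mono (le_max_left _ _) hs⟩
  · rintro ⟨t, n, hn, h⟩
    simp only [List.mem_range, length_initSeg] at hn h
    rw [take_initSeg _ (by omega)] at h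
    obtain ⟨v, hv⟩ := Option.isSome_iff_exists.1 h
    exact ⟨n, Part.dom_iff_mem.2 ⟨v, Code.evaln_sound hv⟩⟩

open Classical in
/-- The first `m` values of the characteristic function of the jump, as far as the oracle segment
`σ` shows them. -/
noncomputable def jumpSeg (m : ℕ) (σ : List ℕ) : List ℕ :=
  (List.range m).map fun e => if Enters σ e then 1 else 0

theorem jumpSeg_initSeg {A : Set ℕ} {m t : ℕ}
    (h : ∀ x < m, x ∈ turingJump A → Enters (initSeg A t) x) :
    jumpSeg m (initSeg A t) = initSeg (turingJump A) m := by
  refine List.map_congr_left fun x hx => ?_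
  have : Enters (initSeg A t) x ↔ x ∈ turingJump A :=
    ⟨fun h => (mem_turingJump_iff A x).2 ⟨t, h⟩, h x (List.mem_range.1 hx)⟩
  simp only [charFn]
  split_ifs <;> tauto

/-- The approximation to the first `t i` values of `∅^{(j)}` obtained from the stages
`t i, t (i + 1), …, t (i + j)`: to approximate `∅^{(j + 1)}` up to `t i`, approximate `∅^{(j)}` up
to `t (i + 1)` and enumerate its jump from that segment. -/
noncomputable def approxJump (t : ℕ → ℕ) : ℕ → ℕ → List ℕ
  | 0, i => List.replicate (t i) 0
  | j + 1, i => jumpSeg (t i) (approxJump t j (i + 1))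

theorem approxJump_congr {t t' : ℕ → ℕ} {i j : ℕ} (h : ∀ n ≤ i + j, t n = t' n) :
    approxJump t j i = approxJump t' j i := by
  induction j generalizing i with
  | zero => simp [approxJump, h i le_rfl]
  | succ j ih =>
    rw [approxJump, approxJump, h i (by omega), ih fun n hn => h n (by omega)]

/-- `StageCorrect j a b`: stage `b` of the enumeration of `∅^{(j + 1)}` from `∅^{(j)}` is already
correct below `a`. -/
def StageCorrect (j a b : ℕ) : Prop :=
  ∀ x < a, x ∈ iterJump (j + 1) → Enters (initSeg (iterJump j) b) x

theorem iterJump_succ (j : ℕ) : iterJump (j + 1) = turingJump (iterJump j) :=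
  Function.iterate_succ_apply' _ _ _

theorem approxJump_eq {t : ℕ → ℕ} {j : ℕ}
    (h : ∀ j' < j, ∀ i, StageCorrect j' (t i) (t (i + 1))) (i : ℕ) :
    approxJump t j i = initSeg (iterJump j) (t i) := by
  induction j generalizing i with
  | zero =>
    refine List.ext_getElem (by simp [approxJump, initSeg]) fun n _ _ => ?_
    simp [approxJump, initSeg, charFn, iterJump]
  | succ j ih =>
    rw [approxJump, ih (fun j' hj' => h j' (by omega)), iterJump_succ]
    refine jumpSeg_initSeg ?_
    rw [← iterJump_succ]
    exact h j (by omega) i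

/-! ### Counting gaps -/

open Classical in
/-- The number of pairs `(a, b)` of consecutive entries of a list with `r a b`. -/
noncomputable def gapCount (r : ℕ → ℕ → Prop) : List ℕ → ℕ
  | [] => 0
  | [_] => 0
  | a :: b :: l => gapCount r (b :: l) + if r a b then 1 else 0

open Classical in
theorem gapCount_append (r : ℕ → ℕ → Prop) (L : List ℕ) (a b : ℕ) (M : List ℕ) :
    gapCount r ((L ++ [a]) ++ b :: M) =
      gapCount r (L ++ [a]) + (if r a b then 1 else 0) + gapCount r (b :: M) := by
  induction L with
  | nil => simp [gapCount, add_comm]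
  | cons c L ih =>
    cases L with
    | nil => simp only [List.nil_append, List.cons_append, gapCount] at ih ⊢; omega
    | cons d L => simp only [List.cons_append, gapCount] at ih ⊢; omega

open Classical in
theorem gapCount_congr {r s : ℕ → ℕ → Prop} {L : List ℕ}
    (h : ∀ a ∈ L, ∀ b ∈ L, r a b ↔ s a b) : gapCount r L = gapCount s L := by
  induction L with
  | nil => rfl
  | cons a L ih =>
    cases L with
    | nil => rfl
    | cons b L =>
      simp only [gapCount]
      rw [ih fun x hx y hy => h x (by simp [hx]) y (by simp [hy])]
      exact congrArg _ (if_congr (h a (by simp) b (by simp)) rfl rfl)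

/-- The gap `(a, b)` is short for the set `A` enumerated by the stages `E`: some number below `a`
belongs to `A` but is not yet enumerated at stage `b`. -/
def ShortGap (A : Set ℕ) (E : ℕ → Set ℕ) (a b : ℕ) : Prop :=
  ∃ x < a, x ∈ A ∧ x ∉ E b

theorem exists_stage_forall_lt {A : Set ℕ} {E : ℕ → Set ℕ} (mono : Monotone E)
    (hA : ∀ x, x ∈ A ↔ ∃ t, x ∈ E t) (M : ℕ) : ∃ N, ∀ x < M, x ∈ A → x ∈ E N := by
  induction M with
  | zero => exact ⟨0, by simp⟩
  | succ M ih =>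
    obtain ⟨N, hN⟩ := ih
    by_cases h : M ∈ A
    · obtain ⟨t, ht⟩ := (hA M).1 h
      refine ⟨max N t, fun x hx hxA => ?_⟩
      rcases Nat.lt_succ_iff_lt_or_eq.1 hx with hx | rfl
      · exact mono (le_max_left _ _) (hN x hx hxA)
      · exact mono (le_max_right _ _) ht
    · refine ⟨N, fun x hx hxA => ?_⟩
      rcases Nat.lt_succ_iff_lt_or_eq.1 hx with hx | rfl
      · exact hN x hx hxA
      · exact absurd hxA h

/-- The parity argument of Blass, Hirst and Simpson. Each `p ∈ S` carries a finite list `X p` with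
last entry `last p`, and `S` is closed under concatenation of these lists along `prec`. If the number
of gaps of `X p` that are short for the finite stage `E (last p)` has constant parity on `S`, then no
gap between `p` and `q` with `prec p q` is short for `A`. -/
theorem mem_stage_of_parity_gapCount {α : Type*} {S : Set α} {prec : α → α → Prop}
    {X : α → List ℕ} {last : α → ℕ} {A : Set ℕ} {E : ℕ → Set ℕ} (mono : Monotone E)
    (hA : ∀ x, x ∈ A ↔ ∃ t, x ∈ E t)
    (hlast : ∀ p ∈ S, ∃ L, X p = L ++ [last p])
    (hle : ∀ p ∈ S, ∀ n ∈ X p, n ≤ last p)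
    (hadd : ∀ p ∈ S, ∀ q ∈ S, prec p q → ∃ u ∈ S, X u = X p ++ X q)
    (hfar : ∀ p ∈ S, ∀ N, ∃ q ∈ S, prec p q ∧ ∀ n ∈ X q, N ≤ n)
    (par : ∀ p ∈ S, ∀ q ∈ S, gapCount (ShortGap (E (last p)) E) (X p) % 2 =
      gapCount (ShortGap (E (last q)) E) (X q) % 2)
    {p q : α} (hp : p ∈ S) (hq : q ∈ S) (hpq : prec p q) :
    ∀ x < last p, x ∈ A → x ∈ E (last q) := by
  have hlast' : ∀ p ∈ S, last p ∈ X p := fun p hp => by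
    obtain ⟨L, hL⟩ := hlast p hp
    simp [hL]
  have hcons : ∀ p ∈ S, ∃ b M, X p = b :: M := fun p hp =>
    List.exists_cons_of_ne_nil (List.ne_nil_of_mem (hlast' p hp))
  have key : ∀ p ∈ S, gapCount (ShortGap A E) (X p) % 2 = 0 := by
    intro p hp
    obtain ⟨N, hN⟩ := exists_stage_forall_lt mono hA (last p)
    obtain ⟨q, hq, hpq, hqN⟩ := hfar p hp N
    obtain ⟨u, hu, hX⟩ := hadd p hp q hq hpq
    obtain ⟨L, hL⟩ := hlast p hp
    obtain ⟨b, M, hb⟩ := hcons q hq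
    have hlu : last u = last q := by
      obtain ⟨L₁, h₁⟩ := hlast u hu
      obtain ⟨L₂, h₂⟩ := hlast q hq
      rw [h₁, h₂, ← List.append_assoc] at hX
      exact List.singleton_inj.1 (List.append_inj_right' hX rfl)
    have hNb : N ≤ b := hqN b (by simp [hb])
    have hNq : N ≤ last q := hqN _ (hlast' q hq)
    -- below `last p`, the set `A` and its stage `last q` agree, so the two notions of short gap
    -- coincide inside `X p`, and the gap between `X p` and `X q` is not short
    have e1 : gapCount (ShortGap (E (last q)) E) (X p) = gapCount (ShortGap A E) (X p) := by
      refine gapCount_congr fun a ha c _ => ?_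
      have := hle p hp a ha
      refine exists_congr fun x => and_congr_right fun hx => and_congr_left fun _ => ?_
      exact ⟨fun h => (hA x).2 ⟨_, h⟩, fun h => mono hNq (hN x (by omega) h)⟩
    have e2 : ¬ ShortGap (E (last q)) E (last p) b := by
      rintro ⟨x, hx, h, h'⟩
      exact h' (mono hNb (hN x hx ((hA x).2 ⟨_, h⟩)))
    have e3 := par u hu q hq
    rw [hX, hlu, hb, hL, gapCount_append, ← hL, ← hb, e1, if_neg e2] at e3
    omega
  obtain ⟨u, hu, hX⟩ := hadd p hp q hq hpq
  obtain ⟨L, hL⟩ := hlast p hp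
  obtain ⟨b, M, hb⟩ := hcons q hq
  -- the three gap counts are even, so the gap between `X p` and `X q` contributes nothing
  have h1 := key p hp
  have h2 := key q hq
  have h3 := key u hu
  rw [hX, hb, hL, gapCount_append, ← hL, ← hb] at h3
  intro x hx hxA
  by_contra hxE
  have hbq : b ≤ last q := hle q hq b (by simp [hb])
  rw [if_pos ⟨x, hx, hxA, fun h => hxE (mono hbq h)⟩] at h3
  omega

/-! ### Closure properties of combinatorial subspaces -/

theorem blockSum_apply_of_ne_zero {k : ℕ} {B : ℕ → FIN k} (hB : IsBlockSequence B) (f : FIN k)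
    {m n : ℕ} (h : (B n).1 m ≠ 0) : blockSum B f m = (B n).1 m - (k - f.1 n) := by
  have val : blockSum B f m = ∑ n ∈ f.1.support, ((B n).1 m - (k - f.1 n)) := by
    simp [blockSum, Finsupp.finsetSum_apply, tetris_iterate_apply]
  rw [val, Finset.sum_eq_single n]
  · intro n' _ hn
    have : (B n').1 m = 0 := by
      by_contra h'
      rcases lt_or_gt_of_ne hn with h1 | h1
      · exact absurd (hB _ _ h1 m (by simpa using h') m (by simpa using h)) (lt_irrefl _)
      · exact absurd (hB _ _ h1 m (by simpa using h) m (by simpa using h')) (lt_irrefl _)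
    simp [this]
  · intro hn
    have := (B n).2.1 m
    have h0 : f.1 n = 0 := by simpa using hn
    omega

theorem blockSum_apply_of_forall_eq_zero {k : ℕ} {B : ℕ → FIN k} (f : FIN k)
    {m : ℕ} (h : ∀ n, (B n).1 m = 0) : blockSum B f m = 0 := by
  simp [blockSum, Finsupp.finsetSum_apply, tetris_iterate_apply, h]

namespace IsCombinatorialSubspace

variable {k : ℕ} {S : Set (FIN (k + 1))}

/-- If `p < q` in a combinatorial subspace, then `p + T^i(q)` belongs to it. -/
theorem exists_add_tetris (hS : IsCombinatorialSubspace S) {p q : FIN (k + 1)} (hp : p ∈ S)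
    (hq : q ∈ S) (hpq : Precedes p.1 q.1) (i : ℕ) :
    ∃ u ∈ S, ∀ n, u.1 n = p.1 n + (q.1 n - i) := by
  obtain ⟨B, hB, rfl⟩ := hS
  obtain ⟨f, hf⟩ := hp
  obtain ⟨g, hg⟩ := hq
  -- if both sums used the block `b_n`, both would be nonzero where `b_n` takes its maximal value
  have disj : ∀ n, f.1 n = 0 ∨ g.1 n = 0 := by
    intro n
    obtain ⟨m, hm⟩ := (B n).2.2
    have hm0 : (B n).1 m ≠ 0 := by omega
    by_contra! h
    have h1 : p.1 m ≠ 0 := by rw [hf, blockSum_apply_of_ne_zero hB f hm0]; omega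
    have h2 : q.1 m ≠ 0 := by rw [hg, blockSum_apply_of_ne_zero hB g hm0]; omega
    exact lt_irrefl _ (hpq m (by simpa using h1) m (by simpa using h2))
  have hval : ∀ n, (f.1 + tetris^[i] g.1) n = f.1 n + (g.1 n - i) := fun n => by
    simp [tetris_iterate_apply]
  let h : FIN (k + 1) := ⟨f.1 + tetris^[i] g.1, fun n => by
    have := f.2.1 n
    have := g.2.1 n
    rw [hval]
    rcases disj n with h | h <;> omega, by
    obtain ⟨n, hn⟩ := f.2.2
    refine ⟨n, ?_⟩
    rw [hval]
    rcases disj n with h | h <;> omega⟩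
  obtain ⟨u, hu⟩ := exists_eq_blockSum hB h
  refine ⟨u, ⟨h, hu⟩, fun m => ?_⟩
  rw [hu, hf, hg]
  by_cases hm : ∃ n, (B n).1 m ≠ 0
  · obtain ⟨n, hn⟩ := hm
    have hh : h.1 n = f.1 n + (g.1 n - i) := hval n
    rw [blockSum_apply_of_ne_zero hB _ hn, blockSum_apply_of_ne_zero hB _ hn,
      blockSum_apply_of_ne_zero hB _ hn, hh]
    have := f.2.1 n
    have := g.2.1 n
    have := (B n).2.1 m
    rcases disj n with h | h <;> omega
  · push Not at hm
    simp [blockSum_apply_of_forall_eq_zero _ hm]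

theorem exists_mem_forall_le (hS : IsCombinatorialSubspace S) (N : ℕ) :
    ∃ q ∈ S, ∀ n ∈ q.1.support, N ≤ n := by
  obtain ⟨B, hB, rfl⟩ := hS
  have hle : ∀ n, ∀ m ∈ (B n).1.support, n ≤ m := by
    intro n
    induction n with
    | zero => simp
    | succ n ih =>
      intro m hm
      obtain ⟨m', hm'⟩ := (B n).2.2
      have hm'' : m' ∈ (B n).1.support := by simp [hm']
      exact (ih m' hm'').trans_lt (hB n (n + 1) (by omega) m' hm'' m hm)
  refine ⟨B N, ⟨⟨Finsupp.single N (k + 1), fun n => ?_, N, by simp⟩, ?_⟩, hle N⟩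
  · rw [Finsupp.single_apply]; split <;> omega
  · simp only [blockSum, Finsupp.support_single N (Nat.succ_ne_zero k), Finset.sum_singleton,
      Finsupp.single_eq_same, Nat.sub_self, Function.iterate_zero, id]

theorem exists_precedes (hS : IsCombinatorialSubspace S) (p : FIN (k + 1)) (N : ℕ) :
    ∃ q ∈ S, Precedes p.1 q.1 ∧ ∀ n ∈ q.1.support, N ≤ n := by
  obtain ⟨q, hq, h⟩ := hS.exists_mem_forall_le (max N (p.1.support.sup id + 1))
  refine ⟨q, hq, fun m hm n hn => ?_, fun n hn => (le_max_left _ _).trans (h n hn)⟩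
  have h1 : id m ≤ p.1.support.sup id := Finset.le_sup hm
  have h2 := (le_max_right _ _).trans (h n hn)
  simp only [id] at h1
  omega

end IsCombinatorialSubspace

/-! ### The coloring -/

/-- The positions at which the sequence `l` takes the value `K`, in increasing order. -/
def topPositions (K : ℕ) (l : List ℕ) : List ℕ :=
  (List.range l.length).filter fun n => l.getD n 0 = K

/-- The last position at which the sequence `l` takes a value at least `K - i`. -/
def lastAtLevel (K : ℕ) (l : List ℕ) (i : ℕ) : ℕ :=
  Nat.findGreatest (fun n => K - i ≤ l.getD n 0) l.length

/-- The `j`-th color bit of the sequence `l`: the parity of the number of gaps between consecutive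
positions of the value `K` that are short for a finite stage of `∅^{(j + 1)}`. The oracle `∅^{(j)}`
is replaced by its approximation along the last positions of the levels `K, K - 1, …, K - j`. -/
noncomputable def gapParity (K j : ℕ) (l : List ℕ) : ℕ :=
  gapCount (ShortGap {x | Enters (approxJump (lastAtLevel K l) j 0) x}
    fun b => {x | Enters ((approxJump (lastAtLevel K l) j 0).take b) x}) (topPositions K l) % 2

/-- The number whose binary digits are the parities of `b 0, …, b (k - 1)`, the last one being the
least significant. -/
def packBits (b : ℕ → ℕ) : ℕ → ℕ
  | 0 => 0
  | k + 1 => 2 * packBits b k + b k % 2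

theorem packBits_lt (b : ℕ → ℕ) (k : ℕ) : packBits b k < 2 ^ k := by
  induction k with
  | zero => simp [packBits]
  | succ k ih => rw [packBits, pow_succ]; omega

theorem mod_two_eq_of_packBits_eq {b c : ℕ → ℕ} {k : ℕ} (h : packBits b k = packBits c k) :
    ∀ j < k, b j % 2 = c j % 2 := by
  induction k with
  | zero => simp
  | succ k ih =>
    simp only [packBits] at h
    intro j hj
    rcases Nat.lt_succ_iff_lt_or_eq.1 hj with hj | rfl
    · exact ih (by omega) j hj
    · omega

namespace FIN

variable {K : ℕ}

/-- The finite sequence `(p(0), …, p(max supp p))` whose number is the code of `p`. -/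
def toList (p : FIN K) : List ℕ :=
  (List.range (p.1.support.sup id + 1)).map p.1

theorem lt_length_toList (p : FIN K) {n : ℕ} (h : p.1 n ≠ 0) : n < p.toList.length := by
  have h1 : id n ≤ p.1.support.sup id := Finset.le_sup (by simpa using h)
  simp only [id] at h1
  simp only [toList, List.length_map, List.length_range]
  omega

theorem getD_toList (p : FIN K) (n : ℕ) : p.toList.getD n 0 = p.1 n := by
  by_cases h : n < p.toList.length
  · rw [List.getD_eq_getElem _ _ h]
    simp [toList]
  · rw [List.getD_eq_default _ _ (by omega)]
    by_contra h'
    exact h (p.lt_length_toList (Ne.symm h'))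

/-- The positions of the maximal value, in increasing order. -/
abbrev top (p : FIN K) : List ℕ := topPositions K p.toList

/-- The last position of a value at least `K - i`. -/
abbrev last (p : FIN K) (i : ℕ) : ℕ := lastAtLevel K p.toList i

theorem mem_top (hK : 0 < K) (p : FIN K) (n : ℕ) : n ∈ p.top ↔ p.1 n = K := by
  simp only [top, topPositions, List.mem_filter, List.mem_range, getD_toList, decide_eq_true_eq,
    and_iff_right_iff_imp]
  exact fun h => p.lt_length_toList (by omega)

theorem sortedLT_top (p : FIN K) : p.top.Pairwise (· < ·) :=
  List.pairwise_lt_range.filter _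

theorem last_eq_iff (p : FIN K) {i m : ℕ} (hi : i < K) :
    p.last i = m ↔ K - i ≤ p.1 m ∧ ∀ n, K - i ≤ p.1 n → n ≤ m := by
  have hle : ∀ n, K - i ≤ p.1 n → n ≤ p.toList.length := fun n hn =>
    (p.lt_length_toList (by omega)).le
  have spec : K - i ≤ p.1 (p.last i) ∧ ∀ n, K - i ≤ p.1 n → n ≤ p.last i := by
    obtain ⟨n, hn⟩ := p.2.2
    simp only [last, lastAtLevel, getD_toList]
    exact ⟨Nat.findGreatest_spec (P := fun n => K - i ≤ p.1 n) (hle n (by omega)) (by omega),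
      fun n hn => Nat.le_findGreatest (hle n hn) hn⟩
  constructor
  · rintro rfl
    exact spec
  · rintro ⟨h1, h2⟩
    exact le_antisymm (h2 _ spec.1) (spec.2 _ h1)

theorem apply_last_zero (hK : 0 < K) (p : FIN K) : p.1 (p.last 0) = K :=
  le_antisymm (p.2.1 _) ((p.last_eq_iff hK).1 rfl).1

theorem le_last_zero (hK : 0 < K) (p : FIN K) {n : ℕ} (h : p.1 n = K) : n ≤ p.last 0 :=
  ((p.last_eq_iff hK).1 rfl).2 n h.ge

theorem exists_top_eq_append (hK : 0 < K) (p : FIN K) : ∃ L, p.top = L ++ [p.last 0] := by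
  have hmem : p.last 0 ∈ p.top := (p.mem_top hK _).2 (p.apply_last_zero hK)
  have hne := List.ne_nil_of_mem hmem
  refine ⟨p.top.dropLast, ?_⟩
  have h := List.dropLast_append_getLast hne
  have hs := p.sortedLT_top
  have h1 := p.le_last_zero hK ((p.mem_top hK _).1 (List.getLast_mem hne))
  rw [← h, List.mem_append, List.mem_singleton] at hmem
  rw [← h, List.pairwise_append] at hs
  rcases hmem with hmem | hmem
  · exact absurd (hs.2.2 _ hmem _ (List.mem_singleton_self _)) (by omega)
  · rw [hmem]; exact h.symm

theorem top_eq_append (hK : 0 < K) {p q u : FIN K} (hpq : Precedes p.1 q.1)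
    (hu : ∀ n, u.1 n = p.1 n + q.1 n) : u.top = p.top ++ q.top := by
  refine u.sortedLT_top.eq_of_mem_iff ?_ fun n => ?_
  · refine List.pairwise_append.2 ⟨p.sortedLT_top, q.sortedLT_top, fun a ha b hb => ?_⟩
    rw [mem_top hK] at ha hb
    exact hpq a (by simp; omega) b (by simp; omega)
  · rw [List.mem_append, mem_top hK, mem_top hK, mem_top hK, hu]
    have := p.2.1 n
    have := q.2.1 n
    by_cases hp : p.1 n = 0
    · omega
    · by_cases hq : q.1 n = 0
      · omega
      · exact absurd (hpq n (by simpa using hp) n (by simpa using hq)) (lt_irrefl _)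

end FIN

theorem Precedes.trans_fin {K : ℕ} (hK : 0 < K) {p : ℕ →₀ ℕ} {q : FIN K} {r : ℕ →₀ ℕ}
    (h1 : Precedes p q.1) (h2 : Precedes q.1 r) : Precedes p r := by
  intro m hm n hn
  obtain ⟨a, ha⟩ := q.2.2
  have ha' : a ∈ q.1.support := by simp; omega
  exact (h1 m hm a ha').trans (h2 a ha' n hn)

/-- The coloring of `FIN_{k + 1}`: its `k` bits are the gap parities for `∅^{(1)}, …, ∅^{(k)}`. -/
noncomputable def gapColoring (k : ℕ) (p : FIN (k + 1)) : Fin (2 ^ k) :=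
  ⟨packBits (fun j => gapParity (k + 1) j p.toList) k, packBits_lt _ _⟩

/-! ### Homogeneous subspaces have correct stages -/

namespace IsCombinatorialSubspace

variable {k : ℕ} {S : Set (FIN (k + 1))}

theorem exists_chain (hS : IsCombinatorialSubspace S) {p : FIN (k + 1)} (hp : p ∈ S) :
    ∃ r : ℕ → FIN (k + 1), r 0 = p ∧ ∀ i, r i ∈ S ∧ Precedes (r i).1 (r (i + 1)).1 := by
  choose nxt h1 h2 _ using fun p => hS.exists_precedes p 0
  refine ⟨fun i => nxt^[i] p, rfl, fun i => ⟨?_, ?_⟩⟩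
  · cases i with
    | zero => exact hp
    | succ i => simp only [Function.iterate_succ_apply']; exact h1 _
  · simp only [Function.iterate_succ_apply']
    exact h2 _

/-- For a chain `r 0 < r 1 < ⋯` in the subspace, `u = r 0 + T (r 1) + ⋯ + T^j (r j)` has the same
top positions as `r 0`, while its lower levels end at the last top positions of `r 1, …, r j`. -/
theorem exists_sum_tetris (hS : IsCombinatorialSubspace S) {r : ℕ → FIN (k + 1)}
    (hr : ∀ i, r i ∈ S ∧ Precedes (r i).1 (r (i + 1)).1) {j : ℕ} (hj : j ≤ k) :
    ∃ u ∈ S, u.top = (r 0).top ∧ ∀ i ≤ j, u.last i = (r i).last 0 := by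
  have hK : 0 < k + 1 := Nat.succ_pos k
  suffices ∃ u ∈ S, u.top = (r 0).top ∧ (∀ i ≤ j, u.last i = (r i).last 0) ∧
      Precedes u.1 (r (j + 1)).1 by
    obtain ⟨u, h1, h2, h3, _⟩ := this
    exact ⟨u, h1, h2, h3⟩
  induction j with
  | zero => exact ⟨r 0, (hr 0).1, rfl, fun i hi => by rw [Nat.le_zero.1 hi], (hr 0).2⟩
  | succ j ih =>
    obtain ⟨u, huS, htop, hlast, hprec⟩ := ih (by omega)
    obtain ⟨v, hvS, hv⟩ := hS.exists_add_tetris huS (hr (j + 1)).1 hprec (j + 1)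
    have disj : ∀ n, u.1 n = 0 ∨ (r (j + 1)).1 n = 0 := by
      intro n
      by_contra! h
      exact lt_irrefl _ (hprec n (by simpa using h.1) n (by simpa using h.2))
    have hlevel : ∀ i ≤ j, ∀ n, k + 1 - i ≤ v.1 n ↔ k + 1 - i ≤ u.1 n := by
      intro i hi n
      have := (r (j + 1)).2.1 n
      rw [hv]
      rcases disj n with h | h <;> omega
    refine ⟨v, hvS, ?_, fun i hi => ?_, ?_⟩
    · rw [← htop]
      refine v.sortedLT_top.eq_of_mem_iff u.sortedLT_top fun n => ?_
      rw [FIN.mem_top hK, FIN.mem_top hK]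
      have := hlevel 0 (by omega) n
      have := u.2.1 n
      have := v.2.1 n
      omega
    · rcases Nat.le_succ_iff.1 hi with hi | hi
      · rw [← hlast i hi, FIN.last_eq_iff _ (by omega)]
        simp only [hlevel i hi]
        exact (u.last_eq_iff (by omega)).1 rfl
      · obtain rfl : i = j + 1 := hi
        rw [FIN.last_eq_iff _ (by omega)]
        have htop' := (r (j + 1)).apply_last_zero hK
        refine ⟨by rw [hv]; omega, fun n hn => ?_⟩
        rw [hv] at hn
        by_cases hn' : (r (j + 1)).1 n = k + 1
        · exact (r (j + 1)).le_last_zero hK hn'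
        · have := (r (j + 1)).2.1 n
          exact (hprec n (by simp; omega) _ (by simp; omega)).le
    · have hsucc := (hr (j + 1)).2
      have htrans := Precedes.trans_fin hK hprec hsucc
      intro m hm n hn
      have hm' : v.1 m ≠ 0 := by simpa using hm
      rw [hv] at hm'
      by_cases h : u.1 m = 0
      · exact hsucc m (by simp; omega) n hn
      · exact htrans m (by simpa using h) n hn

/-- Along a monochromatic subspace, the stages given by the last top positions are correct for all
of the jumps `∅^{(1)}, …, ∅^{(k)}`. -/
theorem stageCorrect_of_isMonochromatic (hS : IsCombinatorialSubspace S)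
    (hc : IsMonochromatic (gapColoring k) S) {j : ℕ} (hj : j < k) :
    ∀ p ∈ S, ∀ q ∈ S, Precedes p.1 q.1 → StageCorrect j (p.last 0) (q.last 0) := by
  have hK : 0 < k + 1 := Nat.succ_pos k
  induction j using Nat.strong_induction_on with
  | _ j ih =>
    obtain ⟨a, ha⟩ := hc
    -- Every `p ∈ S` has the top positions of some `u ∈ S` whose lower levels are so long that the
    -- approximation of `∅^{(j)}` entering its color is correct.
    have hcolor : ∀ p ∈ S, ∃ u ∈ S, gapCount (ShortGap
        {x | Enters (initSeg (iterJump j) (p.last 0)) x}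
        fun b => {x | Enters (initSeg (iterJump j) b) x}) p.top % 2 =
          gapParity (k + 1) j u.toList % 2 := by
      intro p hp
      obtain ⟨r, rfl, hr⟩ := hS.exists_chain hp
      obtain ⟨u, huS, htop, hlast⟩ := hS.exists_sum_tetris hr hj.le
      refine ⟨u, huS, ?_⟩
      have happrox : approxJump (lastAtLevel (k + 1) u.toList) j 0 =
          initSeg (iterJump j) ((r 0).last 0) := by
        rw [approxJump_congr (t' := fun i => (r i).last 0) fun n hn => hlast n (by omega)]
        exact approxJump_eq (fun j' hj' i =>
          ih j' hj' (by omega) _ (hr i).1 _ (hr (i + 1)).1 (hr i).2) 0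
      rw [gapParity, happrox, Nat.mod_mod]
      change _ = gapCount _ u.top % 2
      rw [htop]
      refine congrArg (· % 2) (gapCount_congr fun c _ b hb => ?_)
      have hb := (r 0).le_last_zero hK (((r 0).mem_top hK b).1 hb)
      simp only [ShortGap, take_initSeg _ hb]
    have hbits : ∀ u ∈ S, ∀ v ∈ S,
        gapParity (k + 1) j u.toList % 2 = gapParity (k + 1) j v.toList % 2 := fun u hu v hv =>
      mod_two_eq_of_packBits_eq (Fin.ext_iff.1 ((ha u hu).trans (ha v hv).symm)) j hj
    intro p hp q hq hpq
    refine mem_stage_of_parity_gapCount (X := FIN.top) (last := fun p : FIN (k + 1) => p.last 0)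
      (prec := fun p q => Precedes p.1 q.1)
      (enters_initSeg_mono (iterJump j)) (A := iterJump (j + 1))
      (fun x => by rw [iterJump_succ]; exact mem_turingJump_iff _ x)
      (fun p _ => p.exists_top_eq_append hK)
      (fun p _ n hn => p.le_last_zero hK ((p.mem_top hK n).1 hn))
      (fun p hp q hq hpq => ?_) (fun p _ N => ?_) (fun p hp q hq => ?_) hp hq hpq
    · obtain ⟨u, hu, h⟩ := hS.exists_add_tetris hp hq hpq 0
      exact ⟨u, hu, FIN.top_eq_append hK hpq h⟩
    · obtain ⟨q, hq, hpq, hN⟩ := hS.exists_precedes p N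
      refine ⟨q, hq, hpq, fun n hn => hN n ?_⟩
      rw [FIN.mem_top hK] at hn
      simp; omega
    · obtain ⟨u, hu, hpu⟩ := hcolor p hp
      obtain ⟨v, hv, hqv⟩ := hcolor q hq
      exact hpu.trans ((hbits u hu v hv).trans hqv.symm)

end IsCombinatorialSubspace

/-! ### The coloring is recursive -/

theorem primrecRel_enters : PrimrecRel Enters := by
  have h : PrimrecRel fun (n : ℕ) (p : List ℕ × ℕ) =>
      (Code.evaln p.1.length (Denumerable.ofNat Code p.2)
        (Nat.pair p.2 (Encodable.encode (p.1.take n)))).isSome = true := by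
    refine Primrec.primrecPred (Primrec.of_eq (f := fun q : ℕ × List ℕ × ℕ =>
      (Code.evaln q.2.1.length (Denumerable.ofNat Code q.2.2)
        (Nat.pair q.2.2 (Encodable.encode (q.2.1.take q.1)))).isSome) ?_ (by simp))
    have hσ : Primrec fun q : ℕ × List ℕ × ℕ => q.2.1 := Primrec.fst.comp Primrec.snd
    have he : Primrec fun q : ℕ × List ℕ × ℕ => q.2.2 := Primrec.snd.comp Primrec.snd
    exact Primrec.option_isSome.comp (Code.primrec_evaln.comp
      (Primrec.pair (Primrec.pair (Primrec.list_length.comp hσ) ((Primrec.ofNat _).comp he))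
        (Primrec₂.natPair.comp he (Primrec.encode.comp (Primrec.list_take.comp Primrec.fst hσ)))))
  exact h.exists_mem_list.comp (g := fun p : List ℕ × ℕ => p)
    (Primrec.list_range.comp (Primrec.succ.comp (Primrec.list_length.comp Primrec.fst)))
    Primrec.id

theorem primrec_jumpSeg : Primrec₂ jumpSeg := by
  classical
  refine Primrec.list_map (Primrec.list_range.comp Primrec.fst) ?_
  exact Primrec.ite (primrecRel_enters.comp (Primrec.snd.comp Primrec.fst) Primrec.snd)
    (Primrec.const 1) (Primrec.const 0)

theorem primrec_lastAtLevel (K i : ℕ) : Primrec fun l => lastAtLevel K l i :=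
  Primrec.nat_findGreatest Primrec.list_length
    (Primrec.nat_le.comp (Primrec.const (K - i)) (Primrec.list_getD 0))

theorem primrec_topPositions (K : ℕ) : Primrec (topPositions K) := by
  have h : PrimrecRel fun (n : ℕ) (l : List ℕ) => l.getD n 0 = K :=
    Primrec.eq.comp ((Primrec.list_getD 0).comp Primrec.snd Primrec.fst) (Primrec.const K)
  exact h.listFilter.comp (Primrec.list_range.comp Primrec.list_length) Primrec.id

theorem primrec_approxJump (K j i : ℕ) : Primrec fun l => approxJump (lastAtLevel K l) j i := by
  induction j generalizing i with
  | zero =>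
    refine (Primrec.list_map (Primrec.list_range.comp (primrec_lastAtLevel K i))
      (Primrec.const 0).to₂).of_eq fun l => ?_
    simp [approxJump]
  | succ j ih => exact primrec_jumpSeg.comp (primrec_lastAtLevel K i) (ih (i + 1))

theorem primrec_gapCount {α : Type*} [Primcodable α] {r : α → ℕ → ℕ → Prop} {L : α → List ℕ}
    (hr : PrimrecPred fun p : α × ℕ × ℕ => r p.1 p.2.1 p.2.2) (hL : Primrec L) :
    Primrec fun a => gapCount (r a) (L a) := by
  classical
  have h : Primrec₂ fun (a : α) (s : ℕ × List ℕ × ℕ) =>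
      (s.2.1.head?.casesOn s.2.2 fun b => s.2.2 + if r a s.1 b then 1 else 0 : ℕ) := by
    have hIH : Primrec fun p : α × ℕ × List ℕ × ℕ => p.2.2.2 :=
      Primrec.snd.comp (Primrec.snd.comp Primrec.snd)
    refine Primrec.option_casesOn
      (Primrec.list_head?.comp (Primrec.fst.comp (Primrec.snd.comp Primrec.snd))) hIH ?_
    refine Primrec.nat_add.comp (hIH.comp Primrec.fst)
      (Primrec.ite ?_ (Primrec.const 1) (Primrec.const 0))
    exact hr.comp (Primrec.pair (Primrec.fst.comp Primrec.fst)
      (Primrec.pair (Primrec.fst.comp (Primrec.snd.comp Primrec.fst)) Primrec.snd))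
  refine (Primrec.list_rec hL (Primrec.const 0) h).of_eq fun a => ?_
  induction L a with
  | nil => rfl
  | cons b l ih =>
    cases l with
    | nil => rfl
    | cons c l =>
      simp only [gapCount]
      rw [← ih]
      simp

theorem primrec_gapParity (K j : ℕ) : Primrec (gapParity K j) := by
  have hlate : PrimrecRel fun (x : ℕ) (p : List ℕ × ℕ) =>
      Enters p.1 x ∧ ¬ Enters (p.1.take p.2) x := by
    have hσ : Primrec fun q : ℕ × List ℕ × ℕ => q.2.1 := Primrec.fst.comp Primrec.snd
    exact (primrecRel_enters.comp hσ Primrec.fst).and (primrecRel_enters.comp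
      (Primrec.list_take.comp (Primrec.snd.comp Primrec.snd) hσ) Primrec.fst).not
  refine Primrec.nat_mod.comp (primrec_gapCount ?_ (primrec_topPositions K)) (Primrec.const 2)
  refine (hlate.exists_mem_list.comp
    (f := fun p : List ℕ × ℕ × ℕ => List.range p.2.1)
    (g := fun p => (approxJump (lastAtLevel K p.1) j 0, p.2.2))
    (Primrec.list_range.comp (Primrec.fst.comp Primrec.snd))
    (Primrec.pair ((primrec_approxJump K j 0).comp Primrec.fst)
      (Primrec.snd.comp Primrec.snd))).of_eq fun p => ?_
  simp [ShortGap]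

theorem primrec_packBits {α : Type*} [Primcodable α] {b : α → ℕ → ℕ}
    (hb : ∀ j, Primrec fun a => b a j) (k : ℕ) : Primrec fun a => packBits (b a) k := by
  induction k with
  | zero => exact Primrec.const 0
  | succ k ih =>
    exact Primrec.nat_add.comp (Primrec.nat_mul.comp (Primrec.const 2) ih)
      (Primrec.nat_mod.comp (hb k) (Primrec.const 2))

/-- The list of natural numbers with a given code, and `[]` for a number that is not a code. -/
def decodeList (n : ℕ) : List ℕ :=
  (Encodable.decode (α := List ℕ) n).getD []

theorem primrec_decodeList : Primrec decodeList :=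
  Primrec.option_getD.comp Primrec.decode (Primrec.const [])

theorem decodeList_encode (l : List ℕ) : decodeList (Encodable.encode l) = l := by
  simp [decodeList]

theorem decodeList_code {k : ℕ} (p : FIN k) : decodeList p.code = p.toList :=
  decodeList_encode _

theorem isRecursiveColoring_gapColoring (k : ℕ) : IsRecursiveColoring (gapColoring k) := by
  refine ⟨fun n => packBits (fun j => gapParity (k + 1) j (decodeList n)) k, ?_, fun p => ?_⟩
  · exact ((primrec_packBits (b := fun l j => gapParity (k + 1) j l)
      (primrec_gapParity (k + 1)) k).comp primrec_decodeList).to_comp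
  · simp only [decodeList_code]
    rfl

/-! ### Computing the jumps from a homogeneous subspace -/

/-- The total function `g` is recursive in the set `A`. -/
abbrev RecursiveInSet (A : Set ℕ) (g : ℕ → ℕ) : Prop :=
  Nat.RecursiveIn {(charFn A : ℕ →. ℕ)} (g : ℕ →. ℕ)

namespace RecursiveInSet

variable {A : Set ℕ} {g h : ℕ → ℕ}

theorem of_primrec (h : Primrec g) : RecursiveInSet A g :=
  Nat.Primrec.recursiveIn (Primrec.nat_iff.1 h)

theorem comp (hg : RecursiveInSet A g) (hh : RecursiveInSet A h) :
    RecursiveInSet A fun n => g (h n) :=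
  (Nat.RecursiveIn.comp hg hh).of_eq fun _ => Part.bind_some _ _

theorem pair (hg : RecursiveInSet A g) (hh : RecursiveInSet A h) :
    RecursiveInSet A fun n => Nat.pair (g n) (h n) :=
  (Nat.RecursiveIn.pair hg hh).of_eq fun n => by simp [Seq.seq, PFun.coe_val]

theorem comp₂ {f : ℕ → ℕ → ℕ} (hf : Primrec₂ f) (hg : RecursiveInSet A g)
    (hh : RecursiveInSet A h) : RecursiveInSet A fun n => f (g n) (h n) := by
  have := (of_primrec (A := A) (Primrec₂.unpaired.2 hf)).comp (hg.pair hh)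
  simpa using this

theorem charFn_self (A : Set ℕ) : RecursiveInSet A (charFn A) :=
  Nat.RecursiveIn.oracle _ (Set.mem_singleton _)

/-- Unbounded search for an element of the oracle satisfying a primitive recursive condition. -/
theorem find {P : ℕ → ℕ → Prop} [∀ a, DecidablePred fun n => n ∈ A ∧ P a n] (hP : PrimrecRel P)
    (h : ∀ a, ∃ n, n ∈ A ∧ P a n) : RecursiveInSet A fun a => Nat.find (h a) := by
  classical
  have hu1 : Primrec fun p : ℕ => p.unpair.1 := Primrec.fst.comp Primrec.unpair
  have hu2 : Primrec fun p : ℕ => p.unpair.2 := Primrec.snd.comp Primrec.unpair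
  have hg : RecursiveInSet A fun p =>
      1 - charFn A p.unpair.2 * if P p.unpair.1 p.unpair.2 then 1 else 0 := by
    refine comp₂ (f := fun a b => 1 - a * b) (Primrec.nat_sub.comp (Primrec.const 1)
      Primrec.nat_mul) ((charFn_self A).comp (of_primrec hu2)) (of_primrec ?_)
    exact Primrec.ite (hP.comp hu1 hu2) (Primrec.const 1) (Primrec.const 0)
  have hg0 : ∀ a n, (1 - charFn A n * (if P a n then 1 else 0) = 0) ↔ n ∈ A ∧ P a n := by
    intro a n
    by_cases h1 : n ∈ A <;> by_cases h2 : P a n <;> simp [charFn, h1, h2]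
  refine (Nat.RecursiveIn.rfind hg).of_eq_tot fun a => ?_
  refine Nat.mem_rfind.2 ⟨?_, fun {m} hm => ?_⟩
  · have := (hg0 a _).2 (Nat.find_spec (h a))
    simp [PFun.coe_val] at this ⊢
    exact this
  · have := mt (hg0 a m).1 (Nat.find_min (h a) hm)
    simp [PFun.coe_val] at this ⊢
    exact this

theorem encode_approxJump {t : ℕ → ℕ → ℕ} (ht : ∀ i, RecursiveInSet A fun x => t x i) (j i : ℕ) :
    RecursiveInSet A fun x => Encodable.encode (approxJump (t x) j i) := by
  induction j generalizing i with
  | zero =>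
    have h : Primrec fun m : ℕ => Encodable.encode (List.replicate m 0) := by
      refine Primrec.encode.comp ((Primrec.list_map Primrec.list_range
        (Primrec.const 0).to₂).of_eq fun l => ?_)
      simp
    exact (of_primrec h).comp (ht i)
  | succ j ih =>
    have h : Primrec₂ fun m n : ℕ => Encodable.encode (jumpSeg m (decodeList n)) :=
      Primrec.encode.comp (primrec_jumpSeg.comp Primrec.fst
        (primrec_decodeList.comp Primrec.snd))
    have := comp₂ h (ht i) (ih (i + 1))
    simpa only [decodeList_encode, approxJump] using this

end RecursiveInSet

theorem FIN.precedes_of_take_eq_zero {K : ℕ} {p q : FIN K}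
    (h : ∀ x ∈ q.toList.take p.toList.length, x = 0) : Precedes p.1 q.1 := by
  intro m hm n hn
  have hm := p.lt_length_toList (by simpa using hm)
  have hn' : q.1 n ≠ 0 := by simpa using hn
  by_contra hlt
  refine hn' (h _ (List.mem_take_iff_getElem.2 ⟨n, ?_, ?_⟩))
  · have := q.lt_length_toList hn'
    omega
  · rw [← q.getD_toList, List.getD_eq_getElem]

/-- A subspace whose last top positions provide correct stages computes `∅^{(k)}`: search the
subspace for a chain `r 0 < ⋯ < r k` with `r 0` beyond `x`, and approximate `∅^{(k)}` along it. -/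
theorem IsCombinatorialSubspace.computes_iterJump {k : ℕ} {S : Set (FIN (k + 1))}
    (hS : IsCombinatorialSubspace S)
    (hst : ∀ j < k, ∀ p ∈ S, ∀ q ∈ S, Precedes p.1 q.1 → StageCorrect j (p.last 0) (q.last 0)) :
    Computes (codeSet S) (iterJump k) := by
  classical
  have hK : 0 < k + 1 := Nat.succ_pos k
  let P : ℕ → ℕ → Prop := fun N n => ∀ x ∈ (decodeList n).take N, x = 0
  have hP : PrimrecRel P :=
    (PrimrecPred.forall_mem_list (p := fun x : ℕ => x = 0)
      (Primrec.eq.comp Primrec.id (Primrec.const 0))).comp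
      (Primrec.list_take.comp Primrec.fst (primrec_decodeList.comp Primrec.snd))
  have hex : ∀ N, ∃ n, n ∈ codeSet S ∧ P N n := by
    intro N
    obtain ⟨q, hq, hN⟩ := hS.exists_mem_forall_le N
    refine ⟨q.code, ⟨q, hq, rfl⟩, fun x hx => ?_⟩
    rw [decodeList_code] at hx
    obtain ⟨n, hn, rfl⟩ := List.mem_take_iff_getElem.1 hx
    rw [← List.getD_eq_getElem _ 0, q.getD_toList]
    by_contra h
    have := hN n (by simpa using h)
    omega
  have hnext := RecursiveInSet.find hP hex
  have hspec := fun N => Nat.find_spec (hex N)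
  set next : ℕ → ℕ := fun N => Nat.find (hex N)
  -- `c x 0, c x 1, …` are codes of a chain in `S`: each search starts beyond the whole support of
  -- the element found before it
  let c : ℕ → ℕ → ℕ := fun x i =>
    i.rec (next (x + 1)) fun _ n => next (decodeList n).length
  have hc : ∀ i, RecursiveInSet (codeSet S) fun x => c x i := by
    intro i
    induction i with
    | zero => exact hnext.comp (.of_primrec Primrec.succ)
    | succ i ih =>
      exact hnext.comp ((RecursiveInSet.of_primrec
        (Primrec.list_length.comp primrec_decodeList)).comp ih)
  let t : ℕ → ℕ → ℕ := fun x i => lastAtLevel (k + 1) (decodeList (c x i)) 0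
  have ht : ∀ i, RecursiveInSet (codeSet S) fun x => t x i := fun i =>
    (RecursiveInSet.of_primrec ((primrec_lastAtLevel (k + 1) 0).comp primrec_decodeList)).comp (hc i)
  have hval : ∀ x, (decodeList (Encodable.encode (approxJump (t x) k 0))).getD x 0 =
      charFn (iterJump k) x := by
    intro x
    have hcS : ∀ i, ∃ r ∈ S, r.code = c x i := by
      intro i
      cases i with
      | zero => exact (hspec _).1
      | succ i => exact (hspec _).1
    choose r hrS hr using hcS
    have htr : ∀ i, t x i = (r i).last 0 := fun i => by
      simp only [t, ← hr, decodeList_code]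
    have hprec : ∀ i, Precedes (r i).1 (r (i + 1)).1 := by
      intro i
      have h : P (decodeList (c x i)).length (c x (i + 1)) := (hspec _).2
      refine FIN.precedes_of_take_eq_zero ?_
      simpa only [P, ← hr, decodeList_code] using h
    have hx : x < t x 0 := by
      have h : P (x + 1) (c x 0) := (hspec _).2
      simp only [P, ← hr, decodeList_code] at h
      by_contra hlt
      rw [htr] at hlt
      have h1 := (r 0).apply_last_zero hK
      have h2 := (r 0).lt_length_toList (n := (r 0).last 0) (by omega)
      have h3 := h _ (List.mem_take_iff_getElem.2 ⟨(r 0).last 0, by omega, rfl⟩)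
      rw [← List.getD_eq_getElem _ 0, FIN.getD_toList] at h3
      omega
    rw [decodeList_encode, approxJump_eq, List.getD_eq_getElem _ _ (by rwa [length_initSeg])]
    · simp [initSeg]
    · intro j hj i
      rw [htr i, htr (i + 1)]
      exact hst j hj _ (hrS i) _ (hrS (i + 1)) (hprec i)
  refine RecursiveIn.iff_nat.2 ?_
  have h : Primrec₂ fun n x : ℕ => (decodeList n).getD x 0 :=
    (Primrec.list_getD 0).comp (primrec_decodeList.comp Primrec.fst) Primrec.snd
  have := RecursiveInSet.comp₂ h (RecursiveInSet.encode_approxJump ht k 0)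
    (RecursiveInSet.of_primrec Primrec.id)
  refine Nat.RecursiveIn.of_eq this fun x => ?_
  exact congrArg Part.some (hval x)

theorem mainTheorem1 (k : ℕ) :
    ∃ c : FIN (k + 1) → Fin (2 ^ k),
      IsRecursiveColoring c ∧
      ∀ S : Set (FIN (k + 1)), IsCombinatorialSubspace S → IsMonochromatic c S →
        Computes (codeSet S) (iterJump k) :=
  ⟨gapColoring k, isRecursiveColoring_gapColoring k, fun _ hS hc =>
    hS.computes_iterJump fun _ hj => hS.stageCorrect_of_isMonochromatic hc hj⟩
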